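/- Let a power network consist of finitely many buses $n$ with nominal voltage magnitudes $V_n>0$ and unit ratings $\psi_n>0$, joined by finitely many transmission lines with inductances $\ell_e>0$ and a common resistance-inductance ratio $\rho>0$; let $\omega_0>0$ be the nominal frequency. For a line $e$ joining the distinct buses $n$ and $k$ put $\kappa_e=\omega_0V_nV_k/\ell_e$; let $B$ be an oriented incidence matrix, $L=B\,\mathrm{diag}(\kappa_e)B^{\mathsf T}$ the graph Laplacian, $\mu(s)=1/(s^2+2\rho s+\omega_0^2+\rho^2)$ the normalized line dynamics, and $\gamma_n=2\sum_{e\ni n}\kappa_e$, the sum being over the lines at bus $n$. Let the units have dynamic droop coefficients $m_{p,n}(s)$, real rational transfer functions with positive steady-state droop $m_{p,n}(0)>0$. The small-signal frequency dynamics with load perturbation $\delta_p$ are $$\Delta\omega_n=-\frac{m_{p,n}(s)}{\psi_n}\,\Delta p_n,\qquad \Delta p=\frac{\mu(s)}{s}\,L\,\Delta\omega+\delta_p ;$$ equivalently, they are the negative feedback loop of $\mathrm{diag}(\mu(s)m_{p,n}(s)/\psi_n)$ with $\tfrac1sL$, driven by $\delta_p'=\mu(s)^{-1}\delta_p$. A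 feedback loop with forward path $P(s)$ and feedback path $C(s)$ is called asymptotically stable if it is well posed ($\det(I+PC)\not\equiv0$) and all (finite) poles of the entries of $(I+PC)^{-1}P$, $(I+PC)^{-1}$, $C(I+PC)^{-1}P$ and $C(I+PC)^{-1}$ lie in the open left half-plane; for $P=\mathrm{diag}(m_{p,n}/\psi_n)$, $C=\tfrac{\mu}{s}L$ the first of these is, up to sign, the closed-loop transfer matrix from $\delta_p$ to $\Delta\omega$. **Theorem 1 (Decentralized stability condition).** Assume that all poles of $\mu(s)m_{p,n}(s)$ lie in the open left half-plane for every bus $n$. 1. If there is one $\alpha\in[0,\pi/2)$ such that $$\mathrm{Re}\Big\{e^{j(\alpha-\frac{\pi}{2})}\Big(e^{j\frac{\pi}{2}}+\frac{\gamma_n}{\psi_n\omega_p}\,\mu(j\omega_p)\,m_{p,n}(j\omega_p)\Big)\Big\}>0$$ for every bus $n$ and every frequency $\omega_p\in(0,\infty]$ (at $\omega_p=\infty$ the limit of $\frac{\gamma_n}{\psi_n\omega_p}\mu(j\omega_p)m_{p,n}(j\omega_p)$ as $\omega_p\to\infty$ is required to exist and is inserted for it), then the frequency dynamics, in the original and in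 the rearranged form, are asymptotically stable. 2. Every eigenvalue of $L$ is at most $\max_n\gamma_n$. 3. If every bus has at most $e_{\max}$ lines, every line satisfies $\ell_e\ge\ell_{\min}>0$ and every bus satisfies $V_n\le V_{\max}$, put $\bar\gamma=2e_{\max}\omega_0V_{\max}^2/\ell_{\min}$. Then $\gamma_n\le\bar\gamma$ for every bus $n$, every eigenvalue of $L$ is at most $\bar\gamma$, and the conclusion of part 1 remains true if in its condition $\gamma_n$ is replaced by $\bar\gamma$ at any selection of buses (in particular at all of them). -/

import Mathlib

open Filter Topology

noncomputable section

/-- The (finite) poles of the real rational transfer function `r`: the complex zeros of its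
reduced denominator. -/
def IsPole (r : RatFunc ℝ) (s : ℂ) : Prop := Polynomial.aeval s r.denom = 0

/-- All poles lie in the open left half-plane. -/
def StableTF (r : RatFunc ℝ) : Prop := ∀ s : ℂ, IsPole r s → s.re < 0

/-- A transfer matrix is stable when all poles of all its entries lie in the open left
half-plane. -/
def StableTM {N : Type*} (T : Matrix N N (RatFunc ℝ)) : Prop := ∀ i k, StableTF (T i k)

/-- The value `r(s)` at a complex frequency `s`. -/
def tfEval (r : RatFunc ℝ) (s : ℂ) : ℂ := r.eval (algebraMap ℝ ℂ) s

/-- Asymptotic stability of the negative feedback loop with forward path `P` and feedback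
path `C`, that is, of the equations `w = ν - P (δ + y)`, `y = C w` with exogenous inputs `δ`, `ν`
and loop signals `w`, `y`: the loop is well posed and the transfer matrices from each of the two
inputs to each of the two loop signals are stable. (Up to sign, `(1 + P * C)⁻¹ * P` is the
closed-loop map from the disturbance `δ` to the output `w`.) -/
def FeedbackStable {N : Type*} [Fintype N] [DecidableEq N]
    (P C : Matrix N N (RatFunc ℝ)) : Prop :=
  IsUnit (1 + P * C).det ∧
  StableTM ((1 + P * C)⁻¹ * P) ∧
  StableTM ((1 + P * C)⁻¹) ∧
  StableTM (C * ((1 + P * C)⁻¹ * P)) ∧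
  StableTM (C * (1 + P * C)⁻¹)

/-- A power network with buses `N` and transmission lines `E` with a common
resistance-inductance ratio `rho`. Line `e` connects the distinct buses `src e` and `tgt e`
(arbitrary orientation). -/
structure PowerNetwork (N E : Type*) where
  /-- one end of the line -/
  src : E → N
  /-- the other end of the line -/
  tgt : E → N
  src_ne_tgt : ∀ e, src e ≠ tgt e
  /-- line inductances -/
  ell : E → ℝ
  ell_pos : ∀ e, 0 < ell e
  /-- nominal bus voltage magnitudes -/
  V : N → ℝ
  V_pos : ∀ n, 0 < V n
  /-- unit ratings relative to the system base -/
  psi : N → ℝ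
  psi_pos : ∀ n, 0 < psi n
  /-- nominal frequency -/
  omega0 : ℝ
  omega0_pos : 0 < omega0
  /-- resistance-inductance ratio of the lines -/
  rho : ℝ
  rho_pos : 0 < rho

namespace PowerNetwork

/-- Oriented incidence matrix `B`. -/
def incidence {N E : Type*} [DecidableEq N] (S : PowerNetwork N E) : Matrix N E ℝ :=
  Matrix.of fun n e => if S.src e = n then 1 else if S.tgt e = n then -1 else 0

/-- Line gains `κ_e = ω₀ V_n V_k / ℓ_e`. -/
def kappa {N E : Type*} (S : PowerNetwork N E) (e : E) : ℝ :=
  S.omega0 * S.V (S.src e) * S.V (S.tgt e) / S.ell e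

/-- Graph Laplacian `L = B K Bᵀ` with `K = diag κ`. -/
def laplacian {N E : Type*} [DecidableEq N] [Fintype E] [DecidableEq E]
    (S : PowerNetwork N E) : Matrix N N ℝ :=
  S.incidence * Matrix.diagonal S.kappa * S.incidence.transpose

/-- Normalized line dynamics `μ(s) = 1 / (s² + 2 ρ s + ω₀² + ρ²)`. -/
def mu {N E : Type*} (S : PowerNetwork N E) : RatFunc ℝ :=
  1 / (RatFunc.X ^ 2 + RatFunc.C (2 * S.rho) * RatFunc.X
    + RatFunc.C (S.omega0 ^ 2 + S.rho ^ 2))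

/-- The lines that are incident to bus `n`. -/
def linesAt {N E : Type*} [DecidableEq N] [Fintype E] (S : PowerNetwork N E) (n : N) :
    Finset E :=
  Finset.univ.filter fun e => S.src e = n ∨ S.tgt e = n

/-- Local coupling strength: `γ_n = 2 ∑ (ω₀ / ℓ_{n,k}) V_n V_k`, summed over the lines at `n`. -/
def gamma {N E : Type*} [DecidableEq N] [Fintype E] (S : PowerNetwork N E) (n : N) : ℝ :=
  2 * ∑ e ∈ S.linesAt n, S.omega0 / S.ell e * (S.V (S.src e) * S.V (S.tgt e))

/-- The bound `2 (e_max / ℓ_min) ω₀ V_max²`. -/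
def gammaBar {N E : Type*} (S : PowerNetwork N E) (eMax : ℕ) (ellMin VMax : ℝ) : ℝ :=
  2 * ((eMax : ℝ) / ellMin) * S.omega0 * VMax ^ 2

/-- Unit dynamics `Ψ⁻¹ diag(m_{p,n})`: `Δω_n = -(m_{p,n}(s) / ψ_n) Δp_n`. -/
def units {N E : Type*} [DecidableEq N] (S : PowerNetwork N E) (m : N → RatFunc ℝ) :
    Matrix N N (RatFunc ℝ) :=
  Matrix.diagonal fun n => RatFunc.C (S.psi n)⁻¹ * m n

/-- Network circuit dynamics `B diag(κ_e μ(s)) Bᵀ (1 / s)` from the bus frequencies (integrated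
to phase angles) to the bus power injections. -/
def network {N E : Type*} [DecidableEq N] [Fintype E] [DecidableEq E]
    (S : PowerNetwork N E) : Matrix N N (RatFunc ℝ) :=
  (RatFunc.X : RatFunc ℝ)⁻¹ •
    (S.incidence.map RatFunc.C * Matrix.diagonal (fun e => RatFunc.C (S.kappa e) * S.mu)
      * (S.incidence.map RatFunc.C).transpose)

/-- Asymptotic stability of the small-signal frequency dynamics, both for the loop of the units
with the network circuit, driven by the load perturbations `δ_p`, and for the rearranged loop of
`Ψ⁻¹ μ(s) diag(m_{p,n}(s))` with `L / s`, driven by `δ'_p = μ(s)⁻¹ δ_p`. -/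
def FrequencyDynamicsStable {N E : Type*} [Fintype N] [DecidableEq N] [Fintype E] [DecidableEq E]
    (S : PowerNetwork N E) (m : N → RatFunc ℝ) : Prop :=
  FeedbackStable (S.units m) S.network ∧
  FeedbackStable (S.mu • S.units m)
    ((RatFunc.X : RatFunc ℝ)⁻¹ • S.laplacian.map RatFunc.C)

/-- `h_n(jω) = (g / (ψ_n ω)) μ(jω) m_{p,n}(jω)` with coupling constant `g`. -/
def busResponse {N E : Type*} (S : PowerNetwork N E) (m : N → RatFunc ℝ) (g : ℝ) (n : N)
    (ω : ℝ) : ℂ :=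
  ((g / (S.psi n * ω) : ℝ) : ℂ) * tfEval (S.mu * m n) (Complex.I * ω)

/-- The point `z` lies in the open half-plane
`Re (e^{j(α - π/2)} (e^{jπ/2} + z)) > 0`. -/
def InHalfPlane (α : ℝ) (z : ℂ) : Prop :=
  0 < (Complex.exp (Complex.I * ((α - Real.pi / 2 : ℝ) : ℂ)) *
    (Complex.exp (Complex.I * ((Real.pi / 2 : ℝ) : ℂ)) + z)).re

/-- The decentralized condition with coupling constants `g`: one `α ∈ [0, π/2)` works for all
buses and for all frequencies `0 < ω ≤ ∞`, where the value at `ω = ∞` is the limit. -/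
def DecentralizedCondition {N E : Type*} (S : PowerNetwork N E) (m : N → RatFunc ℝ)
    (g : N → ℝ) : Prop :=
  ∃ α ∈ Set.Ico (0 : ℝ) (Real.pi / 2), ∀ n,
    (∀ ω : ℝ, 0 < ω → InHalfPlane α (S.busResponse m (g n) n ω)) ∧
    ∃ z : ℂ, Tendsto (S.busResponse m (g n) n) atTop (𝓝 z) ∧ InHalfPlane α z

end PowerNetwork

end

/-!
Write `g_n = μ m_{p,n} / ψ_n`, `G = diag (g_n)`, and let `L` be the graph Laplacian. Both loops have
the sensitivity `(1 + G L / s)⁻¹`, so stability comes down to two facts: `s I + G(s) L` is regular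
for `Re s ≥ 0`, `s ≠ 0`, and the pole at `s = 0` is removable.

*Regularity.* Suppose `s x + G(s) L x = 0`, and put `y = L x`. The energy `q = x* L x` is real, and
the Cauchy–Schwarz inequality at each bus gives `q ≥ ∑ w_n` with `w_n = |y_n|² / d_n`, for any
coupling constants `d_n ≥ γ_n`. Taking the inner product of the equation with `y` yields
`∑ w_n (1 + d_n g_n(s) / s) = ∑ w_n - q ≤ 0`. This is impossible for `y ≠ 0` if one factor `Z` with
`Re Z ≥ 0` moves all the points `1 + d_n g_n(s) / s` into the open right half-plane
(`PowerNetwork.eq_zero_of_re_mul_pos`).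

*The factor `Z`.* On the positive imaginary axis the decentralized condition says that `Z = e^{jα}`
will do, and conjugation gives `e^{-jα}` on the negative one. The function `Z(s) = s ^ (2 α / π)` has
exactly these phases on the axis and positive real part in the right half-plane. The real part of
`Z(s) (1 + d_n g_n(s) / s)` is harmonic there, positive on the imaginary axis, and asymptotically
nonnegative at `0` (where `s ^ (2 α / π - 1) g_n(0)` has nonnegative real part) and at infinity
(where the existing limit makes `g_n(s) / s` proper with a real limit). So it is positive throughout
by the maximum modulus principle (`re_cpow_mul_one_add_pos`). No encirclement count is needed.

*The pole at `0`.* Choose `X` with `L X L = L`. Then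
`(s I + L G + 1 - L X) L = L (s I + G L)`, and the first factor is regular in the whole closed right
half-plane because `G(0)` is positive. Hence `K = L (s I + G L)⁻¹` is stable
(`PowerNetwork.exists_stable_mul_eq_laplacian`), and all closed-loop transfer matrices are expressed
by `K`, `G` and `μ`.

The eigenvalue bounds follow from `xᵀ L x ≤ ∑ γ_n x_n²`.
-/

/-! ### The ring of stable transfer functions -/

theorem denom_eval_ne_zero {r : RatFunc ℝ} (hr : StableTF r) {s : ℂ} (hs : 0 ≤ s.re) :
    r.denom.eval₂ (algebraMap ℝ ℂ) s ≠ 0 :=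
  fun h => absurd (hr s h) (not_lt.mpr hs)

theorem StableTF.of_denom_dvd {r : RatFunc ℝ} {q : Polynomial ℝ} (h : r.denom ∣ q)
    (hq : ∀ s : ℂ, q.eval₂ (algebraMap ℝ ℂ) s = 0 → s.re < 0) : StableTF r :=
  fun s hs => hq s (Polynomial.eval₂_eq_zero_of_dvd_of_eval₂_eq_zero _ _ h hs)

theorem StableTF.of_denom_dvd_mul {r a b : RatFunc ℝ} (h : r.denom ∣ a.denom * b.denom)
    (ha : StableTF a) (hb : StableTF b) : StableTF r := by
  refine .of_denom_dvd h fun s hs => ?_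
  rw [Polynomial.eval₂_mul, mul_eq_zero] at hs
  exact hs.elim (ha s) (hb s)

theorem StableTF.add {a b : RatFunc ℝ} (ha : StableTF a) (hb : StableTF b) : StableTF (a + b) :=
  .of_denom_dvd_mul (RatFunc.denom_add_dvd a b) ha hb

theorem StableTF.mul {a b : RatFunc ℝ} (ha : StableTF a) (hb : StableTF b) : StableTF (a * b) :=
  .of_denom_dvd_mul (RatFunc.denom_mul_dvd a b) ha hb

theorem stableTF_algebraMap (p : Polynomial ℝ) :
    StableTF (algebraMap (Polynomial ℝ) (RatFunc ℝ) p) :=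
  fun s hs => by simp [IsPole, RatFunc.denom_algebraMap] at hs

theorem stableTF_C (c : ℝ) : StableTF (RatFunc.C c) := stableTF_algebraMap (Polynomial.C c)

theorem stableTF_X : StableTF RatFunc.X := by
  simpa using stableTF_algebraMap Polynomial.X

theorem StableTF.inv {r : RatFunc ℝ} (h : ∀ s : ℂ, 0 ≤ s.re → tfEval r s ≠ 0) :
    StableTF r⁻¹ := by
  have hr : r ≠ 0 := by
    rintro rfl
    exact h 0 (by simp) (by simp [tfEval])
  refine .of_denom_dvd (RatFunc.denom_inv_dvd hr) fun s hs => ?_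
  by_contra hs'
  exact h s (not_lt.mp hs') (by rw [tfEval, RatFunc.eval, hs, zero_div])

/-- The transfer functions without poles in the closed right half-plane form a ring. Matrices that
are invertible over this ring have stable inverses. -/
def stableSubring : Subring (RatFunc ℝ) where
  carrier := {r | StableTF r}
  mul_mem' := StableTF.mul
  one_mem' := by simpa using stableTF_C 1
  add_mem' := StableTF.add
  zero_mem' := by simpa using stableTF_C 0
  neg_mem' {r} hr := by simpa using (stableTF_C (-1)).mul hr

/-- Evaluation at a point of the closed right half-plane, as a ring homomorphism. -/
noncomputable def stableEval (s : ℂ) (hs : 0 ≤ s.re) : stableSubring →+* ℂ where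
  toFun r := tfEval r s
  map_one' := RatFunc.eval_one _ _
  map_mul' a b := RatFunc.eval_mul _ _ (denom_eval_ne_zero a.2 hs) (denom_eval_ne_zero b.2 hs)
  map_zero' := RatFunc.eval_zero _ _
  map_add' a b := RatFunc.eval_add _ _ (denom_eval_ne_zero a.2 hs) (denom_eval_ne_zero b.2 hs)

theorem stableEval_apply (s : ℂ) (hs : 0 ≤ s.re) (r : stableSubring) :
    stableEval s hs r = tfEval r s := rfl

theorem isUnit_stableSubring {r : stableSubring}
    (h : ∀ (s : ℂ) (hs : 0 ≤ s.re), stableEval s hs r ≠ 0) : IsUnit r := by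
  have hinv : StableTF (r : RatFunc ℝ)⁻¹ := .inv h
  refine IsUnit.of_mul_eq_one ⟨(r : RatFunc ℝ)⁻¹, hinv⟩ (Subtype.ext (mul_inv_cancel₀ ?_))
  intro h0
  exact h 0 (by simp) (by simp [stableEval_apply, h0, tfEval])

/-- A matrix of stable transfer functions has a stable inverse as soon as its values in the closed
right half-plane have trivial left kernels. -/
theorem isUnit_det_of_stableEval {N : Type*} [Fintype N] [DecidableEq N]
    (M : Matrix N N stableSubring)
    (h : ∀ (s : ℂ) (hs : 0 ≤ s.re) (y : N → ℂ),
      Matrix.vecMul y (M.map (stableEval s hs)) = 0 → y = 0) : IsUnit M.det := by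
  refine isUnit_stableSubring fun s hs h0 => ?_
  rw [RingHom.map_det] at h0
  obtain ⟨y, hy, hy0⟩ := Matrix.exists_vecMul_eq_zero_iff.mpr h0
  exact hy (h s hs y hy0)

/-- Constants as stable transfer functions. -/
noncomputable def stableC : ℝ →+* stableSubring where
  toFun c := ⟨RatFunc.C c, stableTF_C c⟩
  map_one' := Subtype.ext (map_one _)
  map_mul' a b := Subtype.ext (map_mul _ a b)
  map_zero' := Subtype.ext (map_zero _)
  map_add' a b := Subtype.ext (map_add _ a b)

theorem coe_stableC (c : ℝ) : (stableC c : RatFunc ℝ) = RatFunc.C c := rfl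

theorem stableEval_stableC (s : ℂ) (hs : 0 ≤ s.re) (c : ℝ) :
    stableEval s hs (stableC c) = c := by
  rw [stableEval_apply, coe_stableC, tfEval, RatFunc.eval_C]; rfl

theorem tfEval_zero_eq_ofReal (r : RatFunc ℝ) :
    tfEval r 0 = (r.eval (RingHom.id ℝ) 0 : ℝ) := by
  simp [tfEval, RatFunc.eval]

theorem tfEval_conj (r : RatFunc ℝ) (s : ℂ) :
    tfEval r (starRingEnd ℂ s) = starRingEnd ℂ (tfEval r s) := by
  have h (p : Polynomial ℝ) : p.eval₂ (algebraMap ℝ ℂ) (starRingEnd ℂ s)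
      = starRingEnd ℂ (p.eval₂ (algebraMap ℝ ℂ) s) := by
    rw [Polynomial.hom_eval₂]
    congr 1
    ext x
    simp
  simp [tfEval, RatFunc.eval, h]

theorem differentiableAt_tfEval {r : RatFunc ℝ} (hr : StableTF r) {s : ℂ} (hs : 0 ≤ s.re) :
    DifferentiableAt ℂ (tfEval r) s := by
  have h (p : Polynomial ℝ) : Differentiable ℂ fun z : ℂ => p.eval₂ (algebraMap ℝ ℂ) z := by
    simpa [← Polynomial.aeval_def] using p.differentiable_aeval
  exact (h _ s).div (h _ s) (denom_eval_ne_zero hr hs)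

/-! ### A minimum principle in the right half-plane -/

/-- A harmonic function `Re F` on the right half-plane that is positive on the imaginary axis except
possibly at `0`, and asymptotically nonnegative at `0` and at infinity, is positive. -/
theorem re_pos_of_re_pos_imaginary_axis {F : ℂ → ℂ}
    (hd : ∀ s : ℂ, 0 ≤ s.re → s ≠ 0 → DifferentiableAt ℂ F s)
    (haxis : ∀ s : ℂ, s.re = 0 → s ≠ 0 → 0 < (F s).re)
    (hzero : ∀ ε > 0, ∃ r > 0, ∀ s : ℂ, 0 ≤ s.re → s ≠ 0 → ‖s‖ ≤ r → -ε ≤ (F s).re)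
    (hinf : ∃ R, ∀ s : ℂ, 0 ≤ s.re → R ≤ ‖s‖ → 0 ≤ (F s).re)
    {s : ℂ} (hs : 0 ≤ s.re) (hs0 : s ≠ 0) : 0 < (F s).re := by
  -- The maximum modulus principle for `exp (-F)` on half-annuli gives `Re F ≥ 0`.
  have hnonneg : ∀ s : ℂ, 0 ≤ s.re → s ≠ 0 → 0 ≤ (F s).re := by
    intro s hs hs0
    by_contra hneg
    obtain ⟨r, hr, hzero⟩ := hzero (-(F s).re / 2) (by linarith)
    obtain ⟨R, hinf⟩ := hinf
    have hrs : r < ‖s‖ := by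
      by_contra h
      have := hzero s hs hs0 (not_lt.mp h)
      linarith
    have hRs : ‖s‖ < R := by
      by_contra h
      exact hneg (hinf s hs (not_lt.mp h))
    set U : Set ℂ := {z | 0 < z.re ∧ r < ‖z‖ ∧ ‖z‖ < R} with hU
    have hUo : IsOpen U :=
      (isOpen_lt continuous_const Complex.continuous_re).inter
        ((isOpen_lt continuous_const continuous_norm).inter
          (isOpen_lt continuous_norm continuous_const))
    have hcl : closure U ⊆ {z | 0 ≤ z.re ∧ r ≤ ‖z‖ ∧ ‖z‖ ≤ R} := by
      refine closure_minimal (fun z hz => ⟨hz.1.le, hz.2.1.le, hz.2.2.le⟩) ?_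
      exact (isClosed_le continuous_const Complex.continuous_re).inter
        ((isClosed_le continuous_const continuous_norm).inter
          (isClosed_le continuous_norm continuous_const))
    have hne : ∀ z ∈ closure U, z ≠ 0 := by
      rintro z hz rfl
      have := (hcl hz).2.1
      simp at this
      linarith
    have hdiff : ∀ z ∈ closure U, DifferentiableAt ℂ (fun z => Complex.exp (-F z)) z :=
      fun z hz => (hd z (hcl hz).1 (hne z hz)).neg.cexp
    have hDC : DiffContOnCl ℂ (fun z => Complex.exp (-F z)) U :=
      ⟨fun z hz => (hdiff z (subset_closure hz)).differentiableWithinAt,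
        fun z hz => (hdiff z hz).continuousAt.continuousWithinAt⟩
    have hbd : Bornology.IsBounded U :=
      Metric.isBounded_ball.subset fun z hz => mem_ball_zero_iff.mpr hz.2.2
    have hsU : s ∈ closure U := by
      rcases hs.lt_or_eq with h | h
      · exact subset_closure ⟨h, hrs, hRs⟩
      · exact absurd (haxis s h.symm hs0).le hneg
    have hbound := Complex.norm_le_of_forall_mem_frontier_norm_le hbd hDC
      (C := Real.exp (-(F s).re / 2)) (fun z hz => ?_) hsU
    · rw [Complex.norm_exp, Real.exp_le_exp, Complex.neg_re] at hbound
      linarith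
    · rw [Complex.norm_exp, Real.exp_le_exp, Complex.neg_re]
      rw [frontier, hUo.interior_eq] at hz
      obtain ⟨h1, h2, h3⟩ := hcl hz.1
      have hz0 := hne z hz.1
      by_cases hz1 : z.re = 0
      · have := haxis z hz1 hz0
        linarith
      by_cases hz2 : ‖z‖ = r
      · have := hzero z h1 hz0 hz2.le
        linarith
      by_cases hz3 : ‖z‖ = R
      · have := hinf z h1 hz3.ge
        linarith
      exact absurd ⟨lt_of_le_of_ne h1 (Ne.symm hz1), lt_of_le_of_ne h2 (Ne.symm hz2),
        lt_of_le_of_ne h3 hz3⟩ hz.2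
  refine (hnonneg s hs hs0).lt_of_ne fun h0 => ?_
  have hsre : 0 < s.re := hs.lt_of_ne fun h => (haxis s h.symm hs0).ne h0
  -- An interior zero would make `|exp (-F)|` constant, contradicting positivity on the axis.
  set U : Set ℂ := {z | 0 < z.re}
  have hUo : IsOpen U := isOpen_lt continuous_const Complex.continuous_re
  have hUc : IsPreconnected U := (convex_halfSpace_re_gt 0).isPreconnected
  have hconst := Complex.norm_eqOn_of_isPreconnected_of_isMaxOn (f := fun z => Complex.exp (-F z))
    hUc hUo (fun z hz => ((hd z (le_of_lt hz)
      (by rintro rfl; simp [U] at hz)).neg.cexp).differentiableWithinAt) (c := s) hsre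
      (fun z hz => by
        have hz0 : z ≠ 0 := by rintro rfl; simp [U] at hz
        simpa [Complex.norm_exp, ← h0] using hnonneg z (le_of_lt hz) hz0)
  have hre : ∀ z ∈ U, (F z).re = 0 := by
    intro z hz
    have := hconst hz
    simpa [Complex.norm_exp, ← h0] using this
  have hI : (F Complex.I).re = 0 := by
    have hcont : ContinuousAt (fun z => (F z).re) Complex.I :=
      Complex.continuous_re.continuousAt.comp (hd _ (by simp) (by simp)).continuousAt
    have hmem : Complex.I ∈ closure U := by
      simp [U]
    have : (𝓝[U] Complex.I).NeBot := mem_closure_iff_nhdsWithin_neBot.mp hmem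
    refine tendsto_nhds_unique (l := 𝓝[U] Complex.I)
      (hcont.tendsto.mono_left nhdsWithin_le_nhds)
      (tendsto_const_nhds.congr' ?_)
    filter_upwards [self_mem_nhdsWithin] with z hz
    exact (hre z hz).symm
  exact (haxis Complex.I (by simp) (by simp)).ne' hI

/-! ### Real powers as multipliers -/

theorem Complex.re_cpow_ofReal {s : ℂ} (hs : s ≠ 0) (b : ℝ) :
    (s ^ (b : ℂ)).re = ‖s‖ ^ b * Real.cos (b * s.arg) := by
  rw [Complex.cpow_def_of_ne_zero hs, Complex.exp_re, Complex.re_mul_ofReal, Complex.im_mul_ofReal,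
    Complex.log_re, Complex.log_im, Real.rpow_def_of_pos (norm_pos_iff.mpr hs), mul_comm b]

theorem Complex.abs_mul_arg_le {s : ℂ} (hs : 0 ≤ s.re) (b : ℝ) :
    |b * s.arg| ≤ |b| * (Real.pi / 2) := by
  rw [abs_mul]
  gcongr
  exact Complex.abs_arg_le_pi_div_two_iff.mpr hs

theorem Complex.cos_mul_le_re_cpow {s : ℂ} (hs : 0 ≤ s.re) (hs0 : s ≠ 0) {b : ℝ} (hb : |b| ≤ 1) :
    ‖s‖ ^ b * Real.cos (b * (Real.pi / 2)) ≤ (s ^ (b : ℂ)).re := by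
  rw [Complex.re_cpow_ofReal hs0]
  gcongr
  rw [← Real.cos_abs (b * s.arg), ← Real.cos_abs (b * (Real.pi / 2))]
  have hpi := Real.pi_pos
  have h := Complex.abs_mul_arg_le hs b
  have h2 : |b * (Real.pi / 2)| = |b| * (Real.pi / 2) := by
    rw [abs_mul, abs_of_pos (by positivity : 0 < Real.pi / 2)]
  rw [h2]
  exact Real.cos_le_cos_of_nonneg_of_le_pi (abs_nonneg _) (by nlinarith) h

theorem Complex.re_cpow_nonneg {s : ℂ} (hs : 0 ≤ s.re) (hs0 : s ≠ 0) {b : ℝ} (hb : |b| ≤ 1) :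
    0 ≤ (s ^ (b : ℂ)).re := by
  refine le_trans ?_ (Complex.cos_mul_le_re_cpow hs hs0 hb)
  have hpi := Real.pi_pos
  have := abs_le.mp hb
  exact mul_nonneg (by positivity) (Real.cos_nonneg_of_neg_pi_div_two_le_of_le (by nlinarith)
    (by nlinarith))

/-- On the positive imaginary axis the multiplier `s ^ (2 α / π)` has the constant phase `α`. -/
theorem Complex.cpow_I_mul {α w : ℝ} (hw : 0 < w) :
    (Complex.I * w) ^ ((2 * α / Real.pi : ℝ) : ℂ)
      = ((w ^ (2 * α / Real.pi) : ℝ) : ℂ) * Complex.exp (Complex.I * α) := by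
  have hpi : (Real.pi : ℂ) ≠ 0 := by exact_mod_cast Real.pi_ne_zero
  rw [mul_comm Complex.I, Complex.cpow_def_of_ne_zero (mul_ne_zero (by exact_mod_cast hw.ne')
    Complex.I_ne_zero), Complex.log_ofReal_mul hw Complex.I_ne_zero, Complex.log_I, add_mul,
    Complex.exp_add, Real.rpow_def_of_pos hw, Complex.ofReal_exp]
  congr 2
  · push_cast
    ring
  · push_cast
    field_simp

/-! ### Limits of rational functions at infinity -/

theorem tendsto_eval₂_reverse_inv (p : Polynomial ℝ) :
    Tendsto (fun s : ℂ => p.reverse.eval₂ (algebraMap ℝ ℂ) s⁻¹) (Bornology.cobounded ℂ)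
      (𝓝 (p.leadingCoeff : ℂ)) := by
  have hc : Continuous fun u : ℂ => p.reverse.eval₂ (algebraMap ℝ ℂ) u := by
    simpa [← Polynomial.aeval_def] using p.reverse.continuous_aeval
  have := (hc.tendsto 0).comp tendsto_inv₀_cobounded
  simpa [Polynomial.eval₂_at_zero, Polynomial.coeff_zero_reverse] using! this

theorem eval₂_eq_pow_mul_reverse (p : Polynomial ℝ) {s : ℂ} (hs : s ≠ 0) :
    p.eval₂ (algebraMap ℝ ℂ) s
      = s ^ p.natDegree * p.reverse.eval₂ (algebraMap ℝ ℂ) s⁻¹ := by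
  let _ := invertibleOfNonzero hs
  rw [← Polynomial.eval₂_reverse_mul_pow, invOf_eq_inv, mul_comm]

/-- The map `ω ↦ jω` escapes to infinity. -/
theorem tendsto_I_mul_cobounded :
    Tendsto (fun w : ℝ => Complex.I * (w : ℂ)) atTop (Bornology.cobounded ℂ) := by
  rw [← tendsto_norm_atTop_iff_cobounded]
  simpa using tendsto_abs_atTop_atTop

/-- If a real rational function has a finite limit along the imaginary axis, then it is proper: the
limit is real and is attained in all directions. -/
theorem exists_tendsto_cobounded_of_tendsto_axis {p q : Polynomial ℝ} (hq : q ≠ 0) {z : ℂ}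
    (h : Tendsto (fun w : ℝ => p.eval₂ (algebraMap ℝ ℂ) (Complex.I * w) /
      q.eval₂ (algebraMap ℝ ℂ) (Complex.I * w)) atTop (𝓝 z)) :
    ∃ c : ℝ, Tendsto (fun s : ℂ => p.eval₂ (algebraMap ℝ ℂ) s / q.eval₂ (algebraMap ℝ ℂ) s)
      (Bornology.cobounded ℂ) (𝓝 (c : ℂ)) := by
  rcases eq_or_ne p 0 with rfl | hp
  · exact ⟨0, by simp⟩
  have hp' : (p.leadingCoeff : ℂ) ≠ 0 := by simpa using hp
  have hq' : (q.leadingCoeff : ℂ) ≠ 0 := by simpa using hq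
  have hT := (tendsto_eval₂_reverse_inv p).div (tendsto_eval₂_reverse_inv q) hq'
  set T : ℂ → ℂ := fun s => p.reverse.eval₂ (algebraMap ℝ ℂ) s⁻¹ /
    q.reverse.eval₂ (algebraMap ℝ ℂ) s⁻¹
  have hne : ∀ᶠ s : ℂ in Bornology.cobounded ℂ, s ≠ 0 := by
    have := (tendsto_norm_cobounded_atTop (E := ℂ)).eventually_gt_atTop 0
    filter_upwards [this] with s hs using norm_pos_iff.mp hs
  rcases le_or_gt p.natDegree q.natDegree with hdeg | hdeg
  · obtain ⟨k, hk⟩ := Nat.exists_eq_add_of_le hdeg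
    refine ⟨0 ^ k * (p.leadingCoeff / q.leadingCoeff), ?_⟩
    have := (tendsto_inv₀_cobounded (α := ℂ)).pow k |>.mul hT
    push_cast
    refine this.congr' ?_
    filter_upwards [hne] with s hs
    rw [eval₂_eq_pow_mul_reverse p hs, eval₂_eq_pow_mul_reverse q hs, hk, pow_add,
      mul_assoc, mul_div_mul_left _ _ (pow_ne_zero _ hs), inv_pow]
    simp only [Pi.div_apply, div_eq_mul_inv, mul_inv]
    ring
  · exfalso
    obtain ⟨k, hk⟩ := Nat.exists_eq_add_of_lt hdeg
    have hlim := (h.div (hT.comp tendsto_I_mul_cobounded) (div_ne_zero hp' hq')).norm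
    refine not_tendsto_nhds_of_tendsto_atTop ?_ _ hlim
    have hT0 : ∀ᶠ s in Bornology.cobounded ℂ, T s ≠ 0 :=
      hT.eventually_ne (div_ne_zero hp' hq')
    refine Tendsto.congr' ?_ (tendsto_pow_atTop (α := ℝ) (n := k + 1) (by simp))
    filter_upwards [eventually_gt_atTop 0, tendsto_I_mul_cobounded.eventually hne,
      tendsto_I_mul_cobounded.eventually hT0] with w hw hs hTs
    have : p.eval₂ (algebraMap ℝ ℂ) (Complex.I * w) / q.eval₂ (algebraMap ℝ ℂ) (Complex.I * w)
        = (Complex.I * w) ^ (k + 1) * T (Complex.I * w) := by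
      rw [eval₂_eq_pow_mul_reverse p hs, eval₂_eq_pow_mul_reverse q hs, hk, add_assoc, pow_add,
        mul_assoc, mul_div_mul_left _ _ (pow_ne_zero _ hs), mul_div_assoc]
    simp only [Pi.div_apply, Function.comp_apply]
    rw [this, mul_div_cancel_right₀ _ hTs]
    simp [abs_of_pos hw]

/-! ### From the imaginary axis to the right half-plane -/

/-- The decentralized condition extends from the imaginary axis to the right half-plane if the
constant phase `α` is replaced by the positive real function `s ^ (2 α / π)`. -/
theorem re_cpow_mul_one_add_pos {g : RatFunc ℝ} (hg : StableTF g)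
    (hg0 : 0 < g.eval (RingHom.id ℝ) 0) {d : ℝ} (hd : 0 ≤ d) {α : ℝ}
    (hα : α ∈ Set.Ico 0 (Real.pi / 2))
    (haxis : ∀ w : ℝ, 0 < w →
      0 < (Complex.exp (Complex.I * α) *
        (1 + d * tfEval g (Complex.I * w) / (Complex.I * w))).re)
    {z : ℂ} (hz : Tendsto (fun w : ℝ => d * tfEval g (Complex.I * w) / (Complex.I * w))
      atTop (𝓝 z))
    (hz0 : 0 < (Complex.exp (Complex.I * α) * (1 + z)).re)
    {s : ℂ} (hs : 0 ≤ s.re) (hs0 : s ≠ 0) :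
    0 < (s ^ ((2 * α / Real.pi : ℝ) : ℂ) * (1 + d * tfEval g s / s)).re := by
  have hpi := Real.pi_pos
  set a : ℝ := 2 * α / Real.pi with ha
  have ha0 : 0 ≤ a := div_nonneg (by linarith [hα.1]) hpi.le
  have ha1 : a < 1 := by
    rw [ha, div_lt_one hpi]
    linarith [hα.2]
  have haα : a * (Real.pi / 2) = α := by
    rw [ha]
    field_simp
  have hcos : 0 < Real.cos α := Real.cos_pos_of_mem_Ioo ⟨by linarith [hα.1], hα.2⟩
  refine re_pos_of_re_pos_imaginary_axis
    (F := fun s => s ^ (a : ℂ) * (1 + d * tfEval g s / s)) ?_ ?_ ?_ ?_ hs hs0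
  · intro s hs hs0
    have hslit : s ∈ Complex.slitPlane := by
      rw [Complex.mem_slitPlane_iff]
      rcases hs.lt_or_eq with h | h
      · exact .inl h
      · exact .inr fun him => hs0 (Complex.ext h.symm him)
    exact (differentiableAt_id.cpow_const hslit).mul
      (((differentiableAt_tfEval hg hs).const_mul _ |>.div differentiableAt_id hs0).const_add 1)
  · have hpos : ∀ w : ℝ, 0 < w → 0 < ((Complex.I * w) ^ (a : ℂ) *
        (1 + d * tfEval g (Complex.I * w) / (Complex.I * w))).re := by
      intro w hw
      rw [ha, Complex.cpow_I_mul hw, mul_assoc, Complex.re_ofReal_mul]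
      exact mul_pos (Real.rpow_pos_of_pos hw _) (haxis w hw)
    intro s hs hs0
    have hsI : s = Complex.I * (s.im : ℂ) := by apply Complex.ext <;> simp [hs]
    have him : s.im ≠ 0 := fun h => hs0 (by rw [hsI, h]; simp)
    rcases him.lt_or_gt with h | h
    · have hconj : s = starRingEnd ℂ (Complex.I * ((-s.im : ℝ) : ℂ)) := by
        apply Complex.ext <;> simp [hs]
      have harg : (Complex.I * ((-s.im : ℝ) : ℂ)).arg ≠ Real.pi := by
        intro harg
        have := (Complex.arg_eq_pi_iff.mp harg).1
        simp at this
      have hF : s ^ (a : ℂ) * (1 + d * tfEval g s / s) = starRingEnd ℂ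
          ((Complex.I * ((-s.im : ℝ) : ℂ)) ^ (a : ℂ) * (1 + d *
            tfEval g (Complex.I * ((-s.im : ℝ) : ℂ)) / (Complex.I * ((-s.im : ℝ) : ℂ)))) := by
        rw [map_mul, map_add, map_div₀, map_mul, map_one, ← tfEval_conj, ← hconj]
        congr 1
        conv_lhs => rw [hconj, Complex.conj_cpow _ _ harg, Complex.conj_ofReal]
        simp
      have := hpos (-s.im) (by linarith)
      rw [← Complex.conj_re, ← hF] at this
      exact this
    · have := hpos s.im h
      rwa [← hsI] at this
  · -- Near `0` the pole term `d g(0) s ^ (a - 1)` has nonnegative real part; the rest converges.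
    set g0 : ℝ := g.eval (RingHom.id ℝ) 0
    have hgz : tfEval g 0 = g0 := tfEval_zero_eq_ofReal g
    have hslope : Tendsto (fun s : ℂ => 1 + d * ((tfEval g s - g0) / s)) (𝓝[≠] 0)
        (𝓝 (1 + d * deriv (tfEval g) 0)) := by
      have := hasDerivAt_iff_tendsto_slope_zero.mp
        (differentiableAt_tfEval hg (s := 0) (by simp)).hasDerivAt
      refine ((this.const_mul (d : ℂ)).const_add 1).congr fun s => ?_
      rw [zero_add, hgz, smul_eq_mul, div_eq_inv_mul]
    have hlim : ∃ l : ℂ, 0 ≤ l.re ∧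
        Tendsto (fun s : ℂ => s ^ (a : ℂ) * (1 + d * ((tfEval g s - g0) / s))) (𝓝[≠] 0)
          (𝓝 l) := by
      rcases ha0.eq_or_lt with h0 | hapos
      · refine ⟨1 + d * deriv (tfEval g) 0, ?_, by simpa [← h0] using hslope⟩
        have hα0 : α = 0 := by rw [← haα, ← h0, zero_mul]
        have hI : Tendsto (fun w : ℝ => Complex.I * (w : ℂ)) (𝓝[>] 0) (𝓝[≠] 0) := by
          refine tendsto_nhdsWithin_iff.mpr ⟨?_, ?_⟩
          · have : Continuous fun w : ℝ => Complex.I * (w : ℂ) := by fun_prop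
            simpa using (this.tendsto 0).mono_left nhdsWithin_le_nhds
          · filter_upwards [self_mem_nhdsWithin] with w hw
            simpa using (ne_of_gt hw : w ≠ 0)
        refine ge_of_tendsto ((Complex.continuous_re.tendsto _).comp (hslope.comp hI)) ?_
        filter_upwards [self_mem_nhdsWithin] with w hw
        have h1 := haxis w hw
        rw [hα0] at h1
        have h2 : (1 + d * ((tfEval g (Complex.I * w) - g0) / (Complex.I * w))).re
            = (1 + d * tfEval g (Complex.I * w) / (Complex.I * w)).re := by
          have : 1 + d * ((tfEval g (Complex.I * w) - g0) / (Complex.I * w))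
            = 1 + d * tfEval g (Complex.I * w) / (Complex.I * w)
              + ((d * g0 / w : ℝ) : ℂ) * Complex.I := by
            have hw' : (w : ℂ) ≠ 0 := by exact_mod_cast (ne_of_gt hw : w ≠ 0)
            push_cast
            field_simp
            linear_combination (-(d : ℂ) * g0) * Complex.I_sq
          rw [this, Complex.add_re, Complex.re_ofReal_mul]
          simp
        simp only [Function.comp_apply, h2]
        simpa using h1.le
      · refine ⟨0, by simp, ?_⟩
        have hpow : Tendsto (fun s : ℂ => s ^ (a : ℂ)) (𝓝[≠] 0) (𝓝 0) := by
          rw [tendsto_zero_iff_norm_tendsto_zero]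
          simp only [Complex.norm_cpow_real]
          have hc : ContinuousAt (fun x : ℝ => x ^ a) 0 :=
            Real.continuousAt_rpow_const _ _ (.inr hapos.le)
          have hn : Tendsto (fun s : ℂ => ‖s‖) (𝓝[≠] 0) (𝓝 0) := by
            simpa using (continuous_norm.tendsto (0 : ℂ)).mono_left nhdsWithin_le_nhds
          simpa [Real.zero_rpow hapos.ne', Function.comp_def] using hc.tendsto.comp hn
        simpa using hpow.mul hslope
    obtain ⟨l, hl, hlim⟩ := hlim
    intro ε hε
    have hev := ((Complex.continuous_re.tendsto _).comp hlim).eventually_const_le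
      (show -ε < l.re by linarith)
    rw [eventually_nhdsWithin_iff, Metric.eventually_nhds_iff] at hev
    obtain ⟨r, hr, hev⟩ := hev
    refine ⟨r / 2, by positivity, fun s hs hs0 hsr => ?_⟩
    have h1 := hev (y := s) (by rw [dist_zero_right]; linarith) hs0
    simp only [Function.comp_apply] at h1
    have h2 : s ^ (a : ℂ) * (1 + d * tfEval g s / s)
        = s ^ (a : ℂ) * (1 + d * ((tfEval g s - g0) / s))
          + ((d * g0 : ℝ) : ℂ) * s ^ ((a - 1 : ℝ) : ℂ) := by
      rw [Complex.ofReal_sub, Complex.ofReal_one, Complex.cpow_sub _ _ hs0, Complex.cpow_one]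
      push_cast
      field_simp
      ring
    rw [h2, Complex.add_re, Complex.re_ofReal_mul]
    have h3 : 0 ≤ (s ^ ((a - 1 : ℝ) : ℂ)).re :=
      Complex.re_cpow_nonneg hs hs0 (abs_le.mpr ⟨by linarith, by linarith⟩)
    have := mul_nonneg (mul_nonneg hd hg0.le) h3
    linarith
  · -- Near infinity `1 + d g(s) / s` is close to a positive number.
    have hfrac : ∀ s : ℂ, d * tfEval g s / s
        = (Polynomial.C d * g.num).eval₂ (algebraMap ℝ ℂ) s /
          (g.denom * Polynomial.X).eval₂ (algebraMap ℝ ℂ) s := by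
      intro s
      simp [tfEval, RatFunc.eval, Polynomial.eval₂_mul]
      ring
    simp only [hfrac] at hz
    obtain ⟨c, hc⟩ := exists_tendsto_cobounded_of_tendsto_axis
      (mul_ne_zero g.denom_ne_zero Polynomial.X_ne_zero) hz
    have hzc : z = c := tendsto_nhds_unique hz (hc.comp tendsto_I_mul_cobounded)
    simp only [← hfrac] at hc
    have hcpos : 0 < 1 + c := by
      have : (Complex.exp (Complex.I * α) * (1 + z)).re = Real.cos α * (1 + c) := by
        rw [hzc, ← Complex.ofReal_one, ← Complex.ofReal_add, Complex.re_mul_ofReal,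
          mul_comm Complex.I, Complex.exp_ofReal_mul_I_re]
      rw [this] at hz0
      exact (pos_iff_pos_of_mul_pos hz0).mp hcos
    have hev := (tendsto_iff_norm_sub_tendsto_zero.mp hc).eventually_le_const
      (mul_pos hcpos hcos)
    have h0 : ∀ᶠ s : ℂ in Bornology.cobounded ℂ, s ≠ 0 := by
      have := (tendsto_norm_cobounded_atTop (E := ℂ)).eventually_gt_atTop 0
      filter_upwards [this] with s hs using norm_pos_iff.mp hs
    have hev := hev.and h0
    rw [← comap_norm_atTop, eventually_comap, eventually_atTop] at hev
    obtain ⟨R, hR⟩ := hev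
    refine ⟨R, fun s hs hsR => ?_⟩
    obtain ⟨hb, hs0⟩ := hR ‖s‖ hsR s rfl
    have h1 : s ^ (a : ℂ) * (1 + d * tfEval g s / s) = ((1 + c : ℝ) : ℂ) * s ^ (a : ℂ)
        + s ^ (a : ℂ) * (d * tfEval g s / s - c) := by
      push_cast
      ring
    have h2 := Complex.cos_mul_le_re_cpow hs hs0 (b := a) (abs_le.mpr ⟨by linarith, ha1.le⟩)
    rw [haα] at h2
    have h3 := (abs_le.mp (Complex.abs_re_le_norm
      (s ^ (a : ℂ) * (d * tfEval g s / s - c)))).1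
    rw [norm_mul, Complex.norm_cpow_real] at h3
    rw [h1, Complex.add_re, Complex.re_ofReal_mul]
    have h4 := mul_le_mul_of_nonneg_left hb (Real.rpow_nonneg (norm_nonneg s) a)
    have h5 := mul_le_mul_of_nonneg_left h2 hcpos.le
    nlinarith

/-! ### The graph Laplacian and the local coupling constants -/

namespace PowerNetwork

variable {N E : Type*}

theorem kappa_pos (S : PowerNetwork N E) (e : E) : 0 < S.kappa e :=
  div_pos (mul_pos (mul_pos S.omega0_pos (S.V_pos _)) (S.V_pos _)) (S.ell_pos e)

/-- The difference of the bus quantities `x` across the line `e`. -/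
def drop {R : Type*} [Sub R] (S : PowerNetwork N E) (x : N → R) (e : E) : R :=
  x (S.src e) - x (S.tgt e)

variable [DecidableEq N]

theorem incidence_apply (S : PowerNetwork N E) (n : N) (e : E) :
    S.incidence n e = (if S.src e = n then 1 else 0) - (if S.tgt e = n then 1 else 0) := by
  have := S.src_ne_tgt e
  by_cases h1 : S.src e = n <;> by_cases h2 : S.tgt e = n <;> simp_all [incidence]

theorem sum_incidence_mul [Fintype N] (S : PowerNetwork N E) {R : Type*} [CommRing R] (φ : ℝ →+* R)
    (x : N → R) (e : E) : ∑ n, φ (S.incidence n e) * x n = S.drop x e := by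
  simp [incidence_apply, drop, sub_mul, Finset.sum_sub_distrib, apply_ite φ]

variable [Fintype E]

theorem gamma_eq (S : PowerNetwork N E) (n : N) :
    S.gamma n = 2 * ∑ e ∈ S.linesAt n, S.kappa e := by
  simp only [gamma, kappa]
  congr 1
  refine Finset.sum_congr rfl fun e _ => ?_
  ring

theorem gamma_nonneg (S : PowerNetwork N E) (n : N) : 0 ≤ S.gamma n := by
  rw [gamma_eq]
  exact mul_nonneg zero_le_two (Finset.sum_nonneg fun e _ => (S.kappa_pos e).le)

theorem gamma_le_gammaBar (S : PowerNetwork N E) {eMax : ℕ} {ellMin VMax : ℝ}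
    (hcard : ∀ n, (S.linesAt n).card ≤ eMax) (hmin : 0 < ellMin) (hell : ∀ e, ellMin ≤ S.ell e)
    (hV : ∀ n, S.V n ≤ VMax) (n : N) : S.gamma n ≤ S.gammaBar eMax ellMin VMax := by
  have hVM : 0 ≤ VMax := (S.V_pos n).le.trans (hV n)
  have hω := S.omega0_pos
  have hc : 0 ≤ S.omega0 / ellMin * (VMax * VMax) := by positivity
  have h1 : ∑ e ∈ S.linesAt n, S.omega0 / S.ell e * (S.V (S.src e) * S.V (S.tgt e))
      ≤ (S.linesAt n).card • (S.omega0 / ellMin * (VMax * VMax)) := by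
    refine Finset.sum_le_card_nsmul _ _ _ fun e _ => ?_
    have h1 := S.V_pos (S.src e)
    have h2 := S.V_pos (S.tgt e)
    gcongr
    exacts [hell e, hV _, hV _]
  have h2 : ((S.linesAt n).card : ℝ) ≤ eMax := by exact_mod_cast hcard n
  rw [nsmul_eq_mul] at h1
  have h3 := mul_le_mul_of_nonneg_right h2 hc
  have h4 : S.gammaBar eMax ellMin VMax = 2 * (eMax * (S.omega0 / ellMin * (VMax * VMax))) := by
    rw [gammaBar]
    ring
  rw [h4, gamma]
  linarith

/-- Summing over the lines at each bus counts every line once for each of its two ends. -/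
theorem sum_linesAt [Fintype N] (S : PowerNetwork N E) (f : N → E → ℝ) :
    ∑ n, ∑ e ∈ S.linesAt n, f n e = ∑ e, (f (S.src e) e + f (S.tgt e) e) := by
  simp only [linesAt, Finset.sum_filter]
  rw [Finset.sum_comm]
  refine Finset.sum_congr rfl fun e _ => ?_
  have h : ∀ n, (if S.src e = n ∨ S.tgt e = n then f n e else 0)
      = (if S.src e = n then f n e else 0) + (if S.tgt e = n then f n e else 0) := by
    intro n
    have := S.src_ne_tgt e
    by_cases h1 : S.src e = n <;> by_cases h2 : S.tgt e = n <;> simp_all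
  simp [h, Finset.sum_add_distrib]

variable [DecidableEq E]

theorem laplacian_apply (S : PowerNetwork N E) (n k : N) :
    S.laplacian n k = ∑ e, S.incidence n e * S.kappa e * S.incidence k e := by
  rw [laplacian, Matrix.mul_apply]
  simp only [Matrix.mul_diagonal, Matrix.transpose_apply]

theorem laplacian_transpose (S : PowerNetwork N E) : S.laplacian.transpose = S.laplacian := by
  ext n k
  rw [Matrix.transpose_apply, laplacian_apply, laplacian_apply]
  exact Finset.sum_congr rfl fun e _ => by ring

variable [Fintype N]

theorem laplacian_mulVec (S : PowerNetwork N E) {R : Type*} [CommRing R] (φ : ℝ →+* R)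
    (x : N → R) (n : N) : (S.laplacian.map φ).mulVec x n
      = ∑ e, φ (S.incidence n e) * φ (S.kappa e) * S.drop x e := by
  simp only [Matrix.mulVec, dotProduct, Matrix.map_apply, laplacian_apply, map_sum, map_mul,
    Finset.sum_mul]
  rw [Finset.sum_comm]
  refine Finset.sum_congr rfl fun e _ => ?_
  rw [← S.sum_incidence_mul φ x e, Finset.mul_sum]
  exact Finset.sum_congr rfl fun k _ => by ring

theorem sum_mul_laplacian_mulVec (S : PowerNetwork N E) {R : Type*} [CommRing R] (φ : ℝ →+* R)
    (x z : N → R) : ∑ n, z n * (S.laplacian.map φ).mulVec x n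
      = ∑ e, φ (S.kappa e) * (S.drop z e * S.drop x e) := by
  simp only [laplacian_mulVec, Finset.mul_sum]
  rw [Finset.sum_comm]
  refine Finset.sum_congr rfl fun e _ => ?_
  rw [← S.sum_incidence_mul φ z e, Finset.sum_mul, Finset.mul_sum]
  exact Finset.sum_congr rfl fun k _ => by ring

theorem laplacian_form_le (S : PowerNetwork N E) (x : N → ℝ) :
    ∑ n, x n * S.laplacian.mulVec x n ≤ ∑ n, S.gamma n * x n ^ 2 := by
  have h := S.sum_mul_laplacian_mulVec (RingHom.id ℝ) x x
  have hid : S.laplacian.map (RingHom.id ℝ) = S.laplacian := by ext; simp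
  rw [hid] at h
  rw [h]
  have : ∑ n, S.gamma n * x n ^ 2 = ∑ n, ∑ e ∈ S.linesAt n, 2 * S.kappa e * x n ^ 2 := by
    refine Finset.sum_congr rfl fun n _ => ?_
    rw [gamma_eq, Finset.mul_sum, Finset.sum_mul]
  rw [this, S.sum_linesAt fun n e => 2 * S.kappa e * x n ^ 2]
  refine Finset.sum_le_sum fun e _ => ?_
  simp only [RingHom.id_apply, drop]
  nlinarith [mul_nonneg (S.kappa_pos e).le (sq_nonneg (x (S.src e) + x (S.tgt e)))]

/-- Tested on an eigenvector, the form bound forces some `γ_n` to be at least the eigenvalue. -/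
theorem exists_eigenvalue_le_gamma (S : PowerNetwork N E) {lam : ℝ}
    (h : Module.End.HasEigenvalue (Matrix.toLin' S.laplacian) lam) :
    ∃ n, lam ≤ S.gamma n := by
  obtain ⟨v, hv⟩ := h.exists_hasEigenvector
  have hev := hv.apply_eq_smul
  rw [Matrix.toLin'_apply] at hev
  by_contra! hlt
  have hle := S.laplacian_form_le v
  obtain ⟨k, hk⟩ := Function.ne_iff.mp hv.2
  have : ∑ n, S.gamma n * v n ^ 2 < ∑ n, v n * S.laplacian.mulVec v n := by
    refine Finset.sum_lt_sum (fun n _ => ?_) ⟨k, Finset.mem_univ k, ?_⟩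
    · rw [hev, Pi.smul_apply, smul_eq_mul]
      nlinarith [hlt n, sq_nonneg (v n)]
    · rw [hev, Pi.smul_apply, smul_eq_mul]
      have hk' : v k ≠ 0 := hk
      nlinarith [hlt k, pow_pos (abs_pos.mpr hk') 2, sq_abs (v k)]
  linarith

/-- The potential energy of the lines at one bus bounds its power injection (Cauchy–Schwarz). -/
theorem norm_sq_laplacian_mulVec_le (S : PowerNetwork N E) (x : N → ℂ) (n : N) :
    ‖(S.laplacian.map (algebraMap ℝ ℂ)).mulVec x n‖ ^ 2
      ≤ S.gamma n * ((∑ e ∈ S.linesAt n, S.kappa e * ‖S.drop x e‖ ^ 2) / 2) := by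
  have h1 : ‖(S.laplacian.map (algebraMap ℝ ℂ)).mulVec x n‖
      ≤ ∑ e ∈ S.linesAt n, S.kappa e * ‖S.drop x e‖ := by
    rw [laplacian_mulVec, linesAt, Finset.sum_filter]
    refine (norm_sum_le _ _).trans (Finset.sum_le_sum fun e _ => ?_)
    have hκ := S.kappa_pos e
    have := S.src_ne_tgt e
    by_cases h1 : S.src e = n <;> by_cases h2 : S.tgt e = n <;>
      simp_all [incidence_apply, abs_of_pos hκ]
  have h2 := Finset.sum_mul_sq_le_sq_mul_sq (S.linesAt n) (fun e => √(S.kappa e))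
    (fun e => √(S.kappa e) * ‖S.drop x e‖)
  have h3 : ∀ e, √(S.kappa e) ^ 2 = S.kappa e := fun e => Real.sq_sqrt (S.kappa_pos e).le
  simp only [mul_pow, h3, ← mul_assoc, ← sq] at h2
  rw [gamma_eq]
  calc _ ≤ (∑ e ∈ S.linesAt n, S.kappa e * ‖S.drop x e‖) ^ 2 := by gcongr
    _ ≤ _ := h2
    _ = _ := by ring

/-- The form `x* L x` is the real potential energy of the lines. -/
theorem sum_conj_laplacian_mulVec (S : PowerNetwork N E) (x : N → ℂ) :
    ∑ n, starRingEnd ℂ ((S.laplacian.map (algebraMap ℝ ℂ)).mulVec x n) * x n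
      = ((∑ e, S.kappa e * ‖S.drop x e‖ ^ 2 : ℝ) : ℂ) := by
  have h : ∀ n, starRingEnd ℂ ((S.laplacian.map (algebraMap ℝ ℂ)).mulVec x n)
      = (S.laplacian.map (algebraMap ℝ ℂ)).mulVec (fun k => starRingEnd ℂ (x k)) n := by
    intro n
    simp [Matrix.mulVec, dotProduct, map_sum]
  simp only [h]
  rw [Finset.sum_congr rfl fun n _ => mul_comm _ _, sum_mul_laplacian_mulVec]
  push_cast
  refine Finset.sum_congr rfl fun e _ => ?_
  rw [← Complex.mul_conj']
  simp [drop]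

/-- If the points `1 + d n * g n / s` are moved into the right half-plane by one common factor `Z`
that lies there itself, then `-s` is not an eigenvalue of `diag (g) * L`. -/
theorem eq_zero_of_re_mul_pos (S : PowerNetwork N E) {d : N → ℝ} (hd : ∀ n, S.gamma n ≤ d n)
    {s Z : ℂ} (hs : s ≠ 0) (hZ : 0 ≤ Z.re) {g : N → ℂ}
    (hpos : ∀ n, 0 < (Z * (1 + d n * g n / s)).re) {x : N → ℂ}
    (hx : ∀ n, s * x n + g n * (S.laplacian.map (algebraMap ℝ ℂ)).mulVec x n = 0) : x = 0 := by
  set y := (S.laplacian.map (algebraMap ℝ ℂ)).mulVec x with hy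
  have hd0 : ∀ n, 0 ≤ d n := fun n => (S.gamma_nonneg n).trans (hd n)
  set w : N → ℝ := fun n => ‖y n‖ ^ 2 / d n with hw
  set q : ℝ := ∑ e, S.kappa e * ‖S.drop x e‖ ^ 2 with hq
  have hw0 : ∀ n, 0 ≤ w n := fun n => div_nonneg (sq_nonneg _) (hd0 n)
  have hE : ∀ n, 0 ≤ (∑ e ∈ S.linesAt n, S.kappa e * ‖S.drop x e‖ ^ 2) / 2 := fun n =>
    div_nonneg (Finset.sum_nonneg fun e _ => mul_nonneg (S.kappa_pos e).le (sq_nonneg _))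
      zero_le_two
  have hyd : ∀ n, ‖y n‖ ^ 2
      ≤ d n * ((∑ e ∈ S.linesAt n, S.kappa e * ‖S.drop x e‖ ^ 2) / 2) := fun n =>
    (S.norm_sq_laplacian_mulVec_le x n).trans (mul_le_mul_of_nonneg_right (hd n) (hE n))
  -- At an isolated bus `d n` may vanish and `w n = 0` is a division by zero, but then `y n = 0`.
  have hwd : ∀ n, ‖y n‖ ^ 2 = w n * d n := by
    intro n
    rcases (hd0 n).eq_or_lt with h | h
    · have h1 := hyd n
      rw [← h, zero_mul] at h1
      rw [← h, mul_zero]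
      exact le_antisymm h1 (sq_nonneg _)
    · rw [hw]
      field_simp
  have hwq : ∑ n, w n ≤ q := by
    calc ∑ n, w n ≤ ∑ n, (∑ e ∈ S.linesAt n, S.kappa e * ‖S.drop x e‖ ^ 2) / 2 :=
          Finset.sum_le_sum fun n _ => div_le_of_le_mul₀ (hd0 n) (hE n)
            ((hyd n).trans_eq (mul_comm _ _))
      _ = q := by
        rw [← Finset.sum_div, S.sum_linesAt fun _ e => S.kappa e * ‖S.drop x e‖ ^ 2,
          hq, Finset.sum_div]
        exact Finset.sum_congr rfl fun e _ => by ring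
  have hsum : ∑ n, (w n : ℂ) * (1 + d n * g n / s) = ((∑ n, w n - q : ℝ) : ℂ) := by
    have h1 := S.sum_conj_laplacian_mulVec x
    have h2 : ∀ n, (w n : ℂ) * (1 + d n * g n / s) = w n - starRingEnd ℂ (y n) * x n := by
      intro n
      have h3 : x n = -(g n * y n / s) := by
        field_simp
        linear_combination hx n
      have h4 : starRingEnd ℂ (y n) * y n = w n * d n := by
        rw [mul_comm, Complex.mul_conj']
        exact_mod_cast hwd n
      rw [h3]
      linear_combination (-(g n / s)) * h4
    rw [Finset.sum_congr rfl fun n _ => h2 n, Finset.sum_sub_distrib, h1,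
      ← hq, Complex.ofReal_sub, Complex.ofReal_sum Finset.univ w]
  have hle : ∑ n, w n * (Z * (1 + d n * g n / s)).re ≤ 0 := by
    have h1 : ∑ n, w n * (Z * (1 + d n * g n / s)).re
        = (Z * ((∑ n, w n - q : ℝ) : ℂ)).re := by
      rw [← hsum, Finset.mul_sum, Complex.re_sum]
      refine Finset.sum_congr rfl fun n _ => ?_
      rw [← Complex.re_ofReal_mul]
      congr 1
      ring
    rw [h1, Complex.re_mul_ofReal]
    exact mul_nonpos_of_nonneg_of_nonpos hZ (by linarith)
  have hterm : ∀ n ∈ Finset.univ, 0 ≤ w n * (Z * (1 + d n * g n / s)).re :=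
    fun n _ => mul_nonneg (hw0 n) (hpos n).le
  have hzero := (Finset.sum_eq_zero_iff_of_nonneg hterm).mp
    (le_antisymm hle (Finset.sum_nonneg hterm))
  ext n
  have hwn : w n = 0 := (mul_eq_zero.mp (hzero n (Finset.mem_univ n))).resolve_right (hpos n).ne'
  have hyn : y n = 0 := by
    have := hwd n
    rw [hwn, zero_mul] at this
    simpa using this
  have := hx n
  rw [hyn, mul_zero, add_zero] at this
  exact (mul_eq_zero.mp this).resolve_left hs

/-- A generalized inverse of the Laplacian, from its spectral decomposition. -/
theorem exists_laplacian_mul_mul_eq (S : PowerNetwork N E) :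
    ∃ X : Matrix N N ℝ, S.laplacian * X * S.laplacian = S.laplacian := by
  have hH : S.laplacian.IsHermitian := by
    rw [Matrix.IsHermitian, Matrix.conjTranspose_eq_transpose_of_trivial, laplacian_transpose]
  set Φ := Unitary.conjStarAlgAut ℝ (Matrix N N ℝ) hH.eigenvectorUnitary
  refine ⟨Φ (Matrix.diagonal fun i => (hH.eigenvalues i)⁻¹), ?_⟩
  have h := hH.spectral_theorem
  have key : ∀ M : Matrix N N ℝ, M = Φ (Matrix.diagonal hH.eigenvalues) →
      M * Φ (Matrix.diagonal fun i => (hH.eigenvalues i)⁻¹) * M = M := by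
    rintro _ rfl
    rw [← map_mul, ← map_mul, Matrix.diagonal_mul_diagonal, Matrix.diagonal_mul_diagonal]
    congr 2
    ext i
    exact mul_inv_mul_cancel _
  exact key _ h

end PowerNetwork

/-! ### Stability of feedback loops -/

theorem StableTM.mul {N : Type*} [Fintype N] {A B : Matrix N N (RatFunc ℝ)} (hA : StableTM A)
    (hB : StableTM B) : StableTM (A * B) := fun i k => by
  rw [Matrix.mul_apply]
  exact stableSubring.sum_mem fun j _ => (hA i j).mul (hB j k)

theorem stableTM_map_coe {N : Type*} (A : Matrix N N stableSubring) :
    StableTM (A.map stableSubring.subtype) := fun i k => (A i k).2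

theorem StableTM.smul {N : Type*} {A : Matrix N N (RatFunc ℝ)} (hA : StableTM A) {c : RatFunc ℝ}
    (hc : StableTF c) : StableTM (c • A) := fun i k => hc.mul (hA i k)

theorem stableTM_diagonal {N : Type*} [DecidableEq N] {g : N → RatFunc ℝ}
    (hg : ∀ n, StableTF (g n)) : StableTM (Matrix.diagonal g) := fun i k => by
  rw [Matrix.diagonal_apply]
  split_ifs
  exacts [hg i, stableSubring.zero_mem]

/-- With a stable forward path, only the sensitivity `T = (1 + P C)⁻¹` and `C T` need checking. -/
theorem FeedbackStable.of_left_inverse {N : Type*} [Fintype N] [DecidableEq N]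
    {P C T : Matrix N N (RatFunc ℝ)} (hP : StableTM P) (hT : T * (1 + P * C) = 1)
    (hTs : StableTM T) (hCT : StableTM (C * T)) : FeedbackStable P C := by
  have hinv : (1 + P * C)⁻¹ = T := Matrix.inv_eq_left_inv hT
  rw [FeedbackStable, hinv]
  refine ⟨Matrix.isUnit_det_of_left_inverse hT, hTs.mul hP, hTs, ?_, hCT⟩
  rw [← Matrix.mul_assoc]
  exact hCT.mul hP

theorem tfEval_mul {a b : RatFunc ℝ} (ha : StableTF a) (hb : StableTF b) {s : ℂ}
    (hs : 0 ≤ s.re) : tfEval (a * b) s = tfEval a s * tfEval b s :=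
  RatFunc.eval_mul _ _ (denom_eval_ne_zero ha hs) (denom_eval_ne_zero hb hs)

theorem tfEval_C (c : ℝ) (s : ℂ) : tfEval (RatFunc.C c) s = c := RatFunc.eval_C _ _

namespace PowerNetwork

variable {N E : Type*}

theorem laplacian_map_transpose [DecidableEq N] [Fintype E] [DecidableEq E]
    (S : PowerNetwork N E) {R : Type*} (φ : ℝ → R) :
    (S.laplacian.map φ).transpose = S.laplacian.map φ := by
  rw [← Matrix.transpose_map, laplacian_transpose]

/-- If `s I + G(s) L` is regular in the closed right half-plane except at `0`, and `G(0)` is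
positive, then the pole at `0` of `(s I + G L)⁻¹` is cancelled by `L`: the matrix
`L (s I + G L)⁻¹` is stable. -/
theorem exists_stable_mul_eq_laplacian [Fintype N] [DecidableEq N] [Fintype E] [DecidableEq E]
    (S : PowerNetwork N E) (G : N → stableSubring)
    (hG0 : ∀ n, 0 < (G n : RatFunc ℝ).eval (RingHom.id ℝ) 0)
    (hG : ∀ s : ℂ, 0 ≤ s.re → s ≠ 0 → ∀ x : N → ℂ,
      (∀ n, s * x n + tfEval (G n) s * (S.laplacian.map (algebraMap ℝ ℂ)).mulVec x n = 0) →
      x = 0) :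
    ∃ K : Matrix N N stableSubring,
      K * ((⟨RatFunc.X, stableTF_X⟩ : stableSubring) • 1
        + Matrix.diagonal G * S.laplacian.map stableC) = S.laplacian.map stableC := by
  obtain ⟨X, hX⟩ := S.exists_laplacian_mul_mul_eq
  have hX' {R : Type _} [CommRing R] (φ : ℝ →+* R) :
      S.laplacian.map φ * X.map φ * S.laplacian.map φ = S.laplacian.map φ := by
    rw [← Matrix.map_mul, ← Matrix.map_mul, hX]
  -- The projection `1 - L X` annihilates `L`; adding it to `s I + L G` removes the pole at `0`.
  have hcomm {R : Type _} [CommRing R] (φ : ℝ →+* R) (s : R) (D : Matrix N N R) :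
      (s • 1 + S.laplacian.map φ * D + 1 - S.laplacian.map φ * X.map φ) * S.laplacian.map φ
        = S.laplacian.map φ * (s • 1 + D * S.laplacian.map φ) := by
    rw [sub_mul, hX', add_mul, add_mul, one_mul, add_sub_cancel_right, mul_add, smul_mul_assoc,
      one_mul, mul_smul_comm, mul_one, mul_assoc]
  set s' : stableSubring := ⟨RatFunc.X, stableTF_X⟩
  set M : Matrix N N stableSubring := s' • 1 + S.laplacian.map stableC * Matrix.diagonal G
    + 1 - S.laplacian.map stableC * X.map stableC with hM
  have hdet : IsUnit M.det := by
    refine isUnit_det_of_stableEval M fun s hs y hy => ?_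
    set Lc := S.laplacian.map (algebraMap ℝ ℂ) with hLc
    set D : Matrix N N ℂ := Matrix.diagonal fun n => tfEval (G n) s
    have hmapC (A : Matrix N N ℝ) :
        (A.map stableC).map (stableEval s hs) = A.map (algebraMap ℝ ℂ) := by
      ext i k
      exact stableEval_stableC s hs _
    have hMs : M.map (stableEval s hs) = s • 1 + Lc * D + 1 - Lc * X.map (algebraMap ℝ ℂ) := by
      have hs' : stableEval s hs s' = s := by
        rw [stableEval_apply]
        exact RatFunc.eval_X _ _
      have h1 : (s' • (1 : Matrix N N stableSubring)).map (stableEval s hs) = s • 1 := by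
        ext i k
        rw [Matrix.map_apply, Matrix.smul_apply, Matrix.smul_apply, smul_eq_mul, map_mul, hs',
          smul_eq_mul, Matrix.one_apply, Matrix.one_apply, apply_ite (stableEval s hs), map_one,
          map_zero]
      have h2 : (Matrix.diagonal G).map (stableEval s hs) = D := by
        rw [Matrix.diagonal_map (map_zero _)]
        rfl
      rw [hM, Matrix.map_sub _ (map_sub _), Matrix.map_add _ (map_add _),
        Matrix.map_add _ (map_add _), h1, Matrix.map_mul, Matrix.map_mul, hmapC, hmapC, h2,
        Matrix.map_one _ (map_zero _) (map_one _)]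
    rw [hMs] at hy
    set z := Matrix.vecMul y Lc with hz
    have hzA : Matrix.vecMul z (s • 1 + D * Lc) = 0 := by
      rw [hz, Matrix.vecMul_vecMul, ← hcomm, ← Matrix.vecMul_vecMul, hy, Matrix.zero_vecMul]
    have hz0 : z = 0 := by
      by_cases hs0 : s = 0
      · subst hs0
        have hconj : Lc.mulVec (star y) = star z := by
          ext n
          have hsymm (k : N) : Lc n k = Lc k n :=
            congrFun (congrFun (S.laplacian_map_transpose (algebraMap ℝ ℂ)) k) n
          simp only [hz, Matrix.mulVec, Matrix.vecMul, dotProduct, Pi.star_apply, star_sum,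
            star_mul, hsymm]
          refine Finset.sum_congr rfl fun k _ => ?_
          simp [hLc]
        rw [zero_smul, zero_add, ← Matrix.vecMul_vecMul] at hzA
        have hform : dotProduct (Matrix.vecMul z D) (star z) = 0 := by
          rw [← hconj, Matrix.dotProduct_mulVec, hzA, zero_dotProduct]
        have hsum : ∑ n, (G n : RatFunc ℝ).eval (RingHom.id ℝ) 0 * ‖z n‖ ^ 2 = 0 := by
          rw [dotProduct] at hform
          have : ((∑ n, (G n : RatFunc ℝ).eval (RingHom.id ℝ) 0 * ‖z n‖ ^ 2 : ℝ) : ℂ) = 0 := by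
            rw [← hform]
            push_cast
            refine Finset.sum_congr rfl fun n _ => ?_
            rw [Matrix.vecMul_diagonal, tfEval_zero_eq_ofReal, ← Complex.mul_conj']
            simp only [Pi.star_apply, RCLike.star_def]
            ring
          exact_mod_cast this
        have hnn : ∀ n ∈ Finset.univ,
            0 ≤ (G n : RatFunc ℝ).eval (RingHom.id ℝ) 0 * ‖z n‖ ^ 2 :=
          fun n _ => mul_nonneg (hG0 n).le (sq_nonneg _)
        ext n
        have := (Finset.sum_eq_zero_iff_of_nonneg hnn).mp hsum n (Finset.mem_univ n)
        simpa [(hG0 n).ne'] using this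
      · by_contra hne
        obtain ⟨x, hx, hAx⟩ := Matrix.exists_mulVec_eq_zero_iff.mpr
          (Matrix.exists_vecMul_eq_zero_iff.mp ⟨z, hne, hzA⟩)
        refine hx (hG s hs hs0 x fun n => ?_)
        have := congrFun hAx n
        rw [Matrix.add_mulVec, Matrix.smul_mulVec, Matrix.one_mulVec,
          ← Matrix.mulVec_mulVec] at this
        simpa only [Pi.add_apply, Pi.smul_apply, smul_eq_mul, D, Matrix.mulVec_diagonal,
          Pi.zero_apply] using this
    rw [Matrix.vecMul_sub, Matrix.vecMul_add, Matrix.vecMul_add, ← Matrix.vecMul_vecMul,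
      ← Matrix.vecMul_vecMul, ← hz, hz0, Matrix.zero_vecMul, Matrix.zero_vecMul, Matrix.vecMul_one,
      Matrix.vecMul_smul, Matrix.vecMul_one, add_zero, sub_zero] at hy
    ext n
    have h1 : (s + 1) * y n = 0 := by
      have := congrFun hy n
      simp only [Pi.add_apply, Pi.smul_apply, smul_eq_mul, Pi.zero_apply] at this
      linear_combination this
    refine (mul_eq_zero.mp h1).resolve_left fun h0 => ?_
    have := congrArg Complex.re h0
    simp at this
    linarith
  refine ⟨M⁻¹ * S.laplacian.map stableC, ?_⟩
  rw [mul_assoc, ← hcomm, ← hM, ← mul_assoc, Matrix.nonsing_inv_mul _ hdet, one_mul]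

/-! ### The line dynamics and the unit dynamics -/

/-- The denominator `s² + 2 ρ s + ω₀² + ρ²` of the line dynamics. -/
noncomputable def lineDenom (S : PowerNetwork N E) : Polynomial ℝ :=
  Polynomial.X ^ 2 + Polynomial.C (2 * S.rho) * Polynomial.X
    + Polynomial.C (S.omega0 ^ 2 + S.rho ^ 2)

theorem mu_eq (S : PowerNetwork N E) :
    S.mu = (algebraMap (Polynomial ℝ) (RatFunc ℝ) S.lineDenom)⁻¹ := by
  simp [mu, lineDenom]

theorem tfEval_lineDenom (S : PowerNetwork N E) (s : ℂ) :
    tfEval (algebraMap (Polynomial ℝ) (RatFunc ℝ) S.lineDenom) s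
      = s ^ 2 + 2 * S.rho * s + (S.omega0 ^ 2 + S.rho ^ 2) := by
  rw [tfEval, RatFunc.eval_algebraMap]
  simp [lineDenom]

theorem tfEval_lineDenom_ne_zero (S : PowerNetwork N E) {s : ℂ} (hs : 0 ≤ s.re) :
    tfEval (algebraMap (Polynomial ℝ) (RatFunc ℝ) S.lineDenom) s ≠ 0 := by
  intro h0
  have h1 : (s + S.rho - Complex.I * S.omega0) * (s + S.rho + Complex.I * S.omega0) = 0 := by
    rw [← h0, tfEval_lineDenom]
    linear_combination (-(S.omega0 : ℂ) ^ 2) * Complex.I_sq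
  have hρ := S.rho_pos
  rcases mul_eq_zero.mp h1 with h | h <;>
  · have := congrArg Complex.re h
    simp at this
    linarith

theorem stableTF_mu (S : PowerNetwork N E) : StableTF S.mu := by
  rw [mu_eq]
  exact .inv fun _ hs => S.tfEval_lineDenom_ne_zero hs

theorem lineDenom_mul_mu (S : PowerNetwork N E) :
    algebraMap (Polynomial ℝ) (RatFunc ℝ) S.lineDenom * S.mu = 1 := by
  rw [mu_eq]
  refine mul_inv_cancel₀ fun h => S.tfEval_lineDenom_ne_zero (s := 0) le_rfl ?_
  rw [h]
  simp [tfEval]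

theorem mu_eval_zero_pos (S : PowerNetwork N E) : 0 < S.mu.eval (RingHom.id ℝ) 0 := by
  have hρ := S.rho_pos
  have h : (S.omega0 ^ 2 + S.rho ^ 2) * S.mu.eval (RingHom.id ℝ) 0 = 1 := by
    have h1 : tfEval (algebraMap (Polynomial ℝ) (RatFunc ℝ) S.lineDenom * S.mu) 0 = 1 := by
      rw [lineDenom_mul_mu]
      exact RatFunc.eval_one _ _
    rw [tfEval_mul (stableTF_algebraMap _) S.stableTF_mu le_rfl, tfEval_lineDenom,
      tfEval_zero_eq_ofReal] at h1
    norm_num at h1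
    exact_mod_cast h1
  exact (pos_iff_pos_of_mul_pos (h ▸ one_pos)).mp (by positivity)

/-- The per-unit dynamics `g_n = μ m_{p,n} / ψ_n` in the rearranged loop. -/
noncomputable def busTF (S : PowerNetwork N E) (m : N → RatFunc ℝ) (n : N) : RatFunc ℝ :=
  S.mu * (RatFunc.C (S.psi n)⁻¹ * m n)

theorem busTF_eq (S : PowerNetwork N E) (m : N → RatFunc ℝ) (n : N) :
    S.busTF m n = RatFunc.C (S.psi n)⁻¹ * (S.mu * m n) := by
  rw [busTF]
  ring

theorem mu_smul_units [DecidableEq N] (S : PowerNetwork N E) (m : N → RatFunc ℝ) :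
    S.mu • S.units m = Matrix.diagonal (S.busTF m) := by
  ext i k
  by_cases h : i = k <;> simp [units, busTF, h]

theorem network_eq [DecidableEq N] [Fintype E] [DecidableEq E] (S : PowerNetwork N E) :
    S.network = S.mu • ((RatFunc.X : RatFunc ℝ)⁻¹ • S.laplacian.map RatFunc.C) := by
  have h : Matrix.diagonal (fun e => RatFunc.C (S.kappa e) * S.mu)
      = S.mu • (Matrix.diagonal S.kappa).map RatFunc.C := by
    ext i k
    by_cases h : i = k <;> simp [h, mul_comm]
  rw [network, h, laplacian, Matrix.map_mul, Matrix.map_mul, Matrix.mul_smul, Matrix.smul_mul,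
    smul_comm, Matrix.transpose_map]

variable {S : PowerNetwork N E} {m : N → RatFunc ℝ}

theorem stableTF_busTF {n : N} (hm : StableTF (S.mu * m n)) : StableTF (S.busTF m n) := by
  rw [busTF_eq]
  exact (stableTF_C _).mul hm

theorem tfEval_busTF {n : N} (hm : StableTF (S.mu * m n)) {s : ℂ} (hs : 0 ≤ s.re) :
    tfEval (S.busTF m n) s = ((S.psi n)⁻¹ : ℝ) * tfEval (S.mu * m n) s := by
  rw [busTF_eq, tfEval_mul (stableTF_C _) hm hs, tfEval_C]

/-- The unit dynamics inherit stability from `μ m_{p,n}`, as `1 / μ` is a polynomial. -/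
theorem stableTF_of_mu_mul {n : N} (hm : StableTF (S.mu * m n)) : StableTF (m n) := by
  have := (stableTF_algebraMap S.lineDenom).mul hm
  rwa [← mul_assoc, lineDenom_mul_mu, one_mul] at this

theorem busTF_eval_zero_pos {n : N} (hm : StableTF (S.mu * m n))
    (hdc : 0 < (m n).eval (RingHom.id ℝ) 0) : 0 < (S.busTF m n).eval (RingHom.id ℝ) 0 := by
  have hμ := S.mu_eval_zero_pos
  have hψ := S.psi_pos n
  have h1 : (((S.busTF m n).eval (RingHom.id ℝ) 0 : ℝ) : ℂ)
      = (((S.psi n)⁻¹ * (S.mu.eval (RingHom.id ℝ) 0 * (m n).eval (RingHom.id ℝ) 0) : ℝ) : ℂ) := by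
    rw [← tfEval_zero_eq_ofReal, tfEval_busTF hm le_rfl,
      tfEval_mul S.stableTF_mu (stableTF_of_mu_mul hm) le_rfl,
      tfEval_zero_eq_ofReal, tfEval_zero_eq_ofReal]
    push_cast
    rfl
  rw [Complex.ofReal_inj.mp h1]
  positivity

theorem inHalfPlane_iff {α : ℝ} {z : ℂ} :
    InHalfPlane α z ↔ 0 < (Complex.exp (Complex.I * α) * (1 + z / Complex.I)).re := by
  have h1 : Complex.exp (Complex.I * ((Real.pi / 2 : ℝ) : ℂ)) = Complex.I := by
    rw [mul_comm]
    push_cast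
    exact Complex.exp_pi_div_two_mul_I
  have h2 : Complex.exp (Complex.I * ((α - Real.pi / 2 : ℝ) : ℂ))
      = Complex.exp (Complex.I * α) / Complex.I := by
    rw [Complex.ofReal_sub, mul_sub, Complex.exp_sub, h1]
  rw [InHalfPlane, h1, h2]
  have : Complex.exp (Complex.I * α) / Complex.I * (Complex.I + z)
      = Complex.exp (Complex.I * α) * (1 + z / Complex.I) := by
    field_simp
  rw [this]

/-! ### The decentralized stability condition -/

variable [Fintype N] [DecidableEq N] [Fintype E] [DecidableEq E]

/-- Under the decentralized condition `s I + G(s) L` is regular in the closed right half-plane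
except at `0`. -/
theorem eq_zero_of_decentralizedCondition (hdc : ∀ n, 0 < (m n).eval (RingHom.id ℝ) 0)
    (hpoles : ∀ n, StableTF (S.mu * m n)) {d : N → ℝ} (hd : ∀ n, S.gamma n ≤ d n)
    (hcond : S.DecentralizedCondition m d) {s : ℂ} (hs : 0 ≤ s.re) (hs0 : s ≠ 0) {x : N → ℂ}
    (hx : ∀ n, s * x n
      + tfEval (S.busTF m n) s * (S.laplacian.map (algebraMap ℝ ℂ)).mulVec x n = 0) : x = 0 := by
  obtain ⟨α, hα, hcond⟩ := hcond
  have hpi := Real.pi_pos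
  have hZ : 0 ≤ (s ^ ((2 * α / Real.pi : ℝ) : ℂ)).re := by
    refine Complex.re_cpow_nonneg hs hs0 (abs_le.mpr ⟨?_, ?_⟩)
    · exact le_trans (by norm_num) (div_nonneg (mul_nonneg zero_le_two hα.1) hpi.le)
    · rw [div_le_one hpi]
      linarith [hα.2]
  refine S.eq_zero_of_re_mul_pos hd hs0 hZ (fun n => ?_) hx
  obtain ⟨haxis, z, hz, hzα⟩ := hcond n
  have hresp : ∀ w : ℝ, d n * tfEval (S.busTF m n) (Complex.I * w) / (Complex.I * w)
      = S.busResponse m (d n) n w / Complex.I := by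
    intro w
    rw [tfEval_busTF (hpoles n) (by simp), busResponse]
    push_cast
    simp only [div_eq_mul_inv, mul_inv]
    ring
  refine re_cpow_mul_one_add_pos (stableTF_busTF (hpoles n))
    (busTF_eval_zero_pos (hpoles n) (hdc n)) ((S.gamma_nonneg n).trans (hd n)) hα
    (fun w hw => ?_) (z := z / Complex.I) ?_ (inHalfPlane_iff.mp hzα) hs hs0
  · rw [hresp]
    exact inHalfPlane_iff.mp (haxis w hw)
  · simp only [hresp]
    exact hz.div_const _

theorem frequencyDynamicsStable_of_gamma_le (hdc : ∀ n, 0 < (m n).eval (RingHom.id ℝ) 0)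
    (hpoles : ∀ n, StableTF (S.mu * m n)) {d : N → ℝ} (hd : ∀ n, S.gamma n ≤ d n)
    (hcond : S.DecentralizedCondition m d) : S.FrequencyDynamicsStable m := by
  have hg : ∀ n, StableTF (S.busTF m n) := fun n => stableTF_busTF (hpoles n)
  obtain ⟨K, hK⟩ := S.exists_stable_mul_eq_laplacian (fun n => ⟨S.busTF m n, hg n⟩)
    (fun n => busTF_eval_zero_pos (hpoles n) (hdc n))
    (fun s hs hs0 x hx => eq_zero_of_decentralizedCondition hdc hpoles hd hcond hs hs0 hx)
  have hX : (RatFunc.X : RatFunc ℝ) ≠ 0 := RatFunc.X_ne_zero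
  set k : Matrix N N (RatFunc ℝ) := K.map stableSubring.subtype with hk
  set l : Matrix N N (RatFunc ℝ) := S.laplacian.map RatFunc.C with hl
  set D : Matrix N N (RatFunc ℝ) := Matrix.diagonal (S.busTF m) with hD
  set C : Matrix N N (RatFunc ℝ) := (RatFunc.X : RatFunc ℝ)⁻¹ • l with hC
  -- `k = L (s I + G L)⁻¹`; hence `(1 + G L / s)⁻¹ = 1 - G k` and `(L / s) (1 + G L / s)⁻¹ = k`.
  have hkl : k * (1 + D * C) = C := by
    have h := congrArg (fun A => A.map stableSubring.subtype) hK
    simp only [Matrix.map_mul, Matrix.map_add _ (map_add stableSubring.subtype)] at h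
    have h1 : ((⟨RatFunc.X, stableTF_X⟩ : stableSubring) •
        (1 : Matrix N N stableSubring)).map stableSubring.subtype
        = (RatFunc.X : RatFunc ℝ) • (1 : Matrix N N (RatFunc ℝ)) := by
      ext i j
      by_cases hij : i = j <;> simp [hij]
    have h2 : (Matrix.diagonal fun n => (⟨S.busTF m n, hg n⟩ : stableSubring)).map
        stableSubring.subtype = D := by
      rw [Matrix.diagonal_map (map_zero _)]
      rfl
    have h3 : (S.laplacian.map stableC).map stableSubring.subtype = l := rfl
    rw [h1, h2, h3] at h
    have h4 : 1 + D * C = (RatFunc.X : RatFunc ℝ)⁻¹ • ((RatFunc.X : RatFunc ℝ) • 1 + D * l) := by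
      rw [smul_add, inv_smul_smul₀ hX, hC, mul_smul_comm]
    rw [h4, mul_smul_comm, h]
  have hT : (1 - D * k) * (1 + D * C) = 1 := by
    rw [sub_mul, one_mul, mul_assoc, hkl, add_sub_cancel_right]
  have hCT : C * (1 - D * k) = k := by
    rw [← hkl, mul_assoc, mul_eq_one_comm.mp hT, mul_one]
  have hks : StableTM k := stableTM_map_coe K
  have hDs : StableTM D := stableTM_diagonal hg
  have hTs : StableTM (1 - D * k) := fun i j => by
    refine stableSubring.sub_mem ?_ (hDs.mul hks i j)
    rw [Matrix.one_apply]
    split_ifs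
    exacts [stableSubring.one_mem, stableSubring.zero_mem]
  refine ⟨?_, ?_⟩
  · have hPC : S.units m * S.network = D * C := by
      rw [network_eq, hD, ← mu_smul_units, mul_smul_comm, smul_mul_assoc]
    refine .of_left_inverse (T := 1 - D * k)
      (stableTM_diagonal fun n => (stableTF_C _).mul (stableTF_of_mu_mul (hpoles n)))
      (by rw [hPC, hT]) hTs ?_
    rw [network_eq, smul_mul_assoc, hCT]
    exact hks.smul S.stableTF_mu
  · rw [mu_smul_units]
    exact .of_left_inverse hDs hT hTs (by rw [hCT]; exact hks)

end PowerNetwork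

theorem theorem1 {N E : Type*} [Fintype N] [DecidableEq N] [Fintype E] [DecidableEq E]
    (S : PowerNetwork N E) (m : N → RatFunc ℝ)
    -- positive steady-state droop coefficients
    (hdc : ∀ n, 0 < (m n).eval (RingHom.id ℝ) 0)
    -- all poles of `μ(s) m_{p,n}(s)` lie in the open left half-plane
    (hpoles : ∀ n, StableTF (S.mu * m n)) :
    -- the decentralized condition with the local coupling constants implies stability
    (S.DecentralizedCondition m S.gamma → S.FrequencyDynamicsStable m) ∧
    -- the local coupling constants bound the eigenvalues of the Laplacian
    (∀ lam : ℝ, Module.End.HasEigenvalue (Matrix.toLin' S.laplacian) lam →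
      ∃ n, lam ≤ S.gamma n) ∧
    -- at any selection of buses `γ_n` may be replaced by its upper bound
    (∀ (eMax : ℕ) (ellMin VMax : ℝ), (∀ n, (S.linesAt n).card ≤ eMax) →
      0 < ellMin → (∀ e, ellMin ≤ S.ell e) → (∀ n, S.V n ≤ VMax) →
      (∀ n, S.gamma n ≤ S.gammaBar eMax ellMin VMax) ∧
      (∀ lam : ℝ, Module.End.HasEigenvalue (Matrix.toLin' S.laplacian) lam →
        lam ≤ S.gammaBar eMax ellMin VMax) ∧
      ∀ g : N → ℝ, (∀ n, g n = S.gamma n ∨ g n = S.gammaBar eMax ellMin VMax) →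
        S.DecentralizedCondition m g → S.FrequencyDynamicsStable m) := by
  refine ⟨PowerNetwork.frequencyDynamicsStable_of_gamma_le hdc hpoles fun n => le_rfl,
    fun lam hlam => S.exists_eigenvalue_le_gamma hlam, ?_⟩
  intro eMax ellMin VMax hcard hmin hell hV
  have hbar := S.gamma_le_gammaBar hcard hmin hell hV
  refine ⟨hbar, fun lam hlam => ?_, fun g hg => ?_⟩
  · obtain ⟨n, hn⟩ := S.exists_eigenvalue_le_gamma hlam
    exact hn.trans (hbar n)
  · refine PowerNetwork.frequencyDynamicsStable_of_gamma_le hdc hpoles fun n => ?_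
    rcases hg n with h | h
    · exact h.ge
    · exact (hbar n).trans h.ge
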